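/- Let $X$ be a complex Banach space and let $u:\mathbb{R}\to X$ be bounded and continuous. For $\varphi\in L^1(\mathbb{R})$ (complex-valued) put $\hat\varphi(s)=\int_{\mathbb{R}} e^{-ist}\varphi(t)\,dt$ and $(\varphi*u)(s)=\int_{\mathbb{R}}\varphi(s-t)u(t)\,dt$. The Beurling spectrum of $u$ is $$\operatorname{Spec}(u)=\{\xi\in\mathbb{R}:\ \forall\varepsilon>0\ \exists\varphi\in L^1(\mathbb{R})\text{ with }\operatorname{supp}\hat\varphi\subset(\xi-\varepsilon,\xi+\varepsilon)\text{ and }\varphi*u\neq0\},$$ and its Beurling spectral radius is $\rho(u)=\sup\{|\xi|:\xi\in\operatorname{Spec}(u)\}\in[0,\infty]$, with $\sup\emptyset=0$. For any $f:\mathbb{R}\to X$ let $\|f\|_\infty=\sup_{t\in\mathbb{R}}\|f(t)\|\in[0,\infty]$, and let $D^nu$ denote the $n$-th derivative of $u$. If $\operatorname{Spec}(u)$ is compact, then $u$ is infinitely differentiable, every derivative $D^nu$ is bounded and continuous, and $$\lim_{n\to\infty}\|D^nu\|_\infty^{1/n}=\rho(u).$$ Conversely, if $u$ is infinitely differentiable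 and $\liminf_{n\to\infty}\|D^nu\|_\infty^{1/n}<\infty$, then $\operatorname{Spec}(u)$ is compact. -/

import Mathlib

open MeasureTheory Filter Topology BoundedContinuousFunction
open scoped ENNReal ContDiff

noncomputable section

/-- The Fourier transform with angular frequency, `φ̂(s) = ∫ e^{-ist} φ(t) dt`. -/
def angularFourier (φ : ℝ → ℂ) (s : ℝ) : ℂ :=
  ∫ t : ℝ, Complex.exp (-(Complex.I * s * t)) * φ t

variable {X : Type*} [NormedAddCommGroup X] [NormedSpace ℂ X]

/-- The convolution `(φ * u)(s) = ∫ φ(t) u(s - t) dt = ∫ φ(s - t) u(t) dt` of a scalar function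
with a vector-valued one. -/
def scalarConv (φ : ℝ → ℂ) (u : ℝ → X) : ℝ → X :=
  convolution φ u (ContinuousLinearMap.lsmul ℂ ℂ) volume

/-- The Beurling spectrum of a bounded continuous function: the set of all `ξ` such that for
every `ε > 0` some `φ ∈ L¹(ℝ)` satisfies `supp φ̂ ⊆ (ξ - ε, ξ + ε)` and `φ * u ≠ 0`. -/
def beurlingSpectrum (u : ℝ →ᵇ X) : Set ℝ :=
  {ξ : ℝ | ∀ ε : ℝ, 0 < ε → ∃ φ : ℝ → ℂ, Integrable φ ∧
    tsupport (angularFourier φ) ⊆ Set.Ioo (ξ - ε) (ξ + ε) ∧ scalarConv φ u ≠ 0}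

/-- The Beurling spectral radius `ρ(u) = sup {|ξ| : ξ ∈ Spec(u)}`, as an element of `[0, ∞]`
(so it is `0` if the spectrum is empty). -/
def beurlingRadius (u : ℝ →ᵇ X) : ℝ≥0∞ :=
  ⨆ ξ ∈ beurlingSpectrum u, ENNReal.ofReal |ξ|

/-- The supremum norm `sup {‖f(t)‖ : t ∈ ℝ}` in `[0, ∞]` of an arbitrary function; it is `∞`
exactly if `f` is unbounded. -/
def supENorm (f : ℝ → X) : ℝ≥0∞ :=
  ⨆ t : ℝ, ‖f t‖ₑ

end

/-!
Convolution with `φ ∈ L¹` acts on `u` as a Fourier multiplier with symbol `φ̂`, and differentiation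
has the symbol `s ↦ i s`. For a compactly supported smooth symbol `χ` write
`K χ = angularFourierInv χ`, so that `(K χ)^ = χ`.

*Localization.* The spectrum is the support of the map `χ ↦ K χ * u`. By definition `K χ * u = 0` if
`χ` is supported in a short interval around a point off the spectrum; a smooth partition of unity
gives the same for every compactly supported `χ` whose support misses `Spec(u)`
(`scalarConv_angularFourierInv_eq_zero_of_disjoint`). Hence `K χ * u` does not change when `χ` is
modified away from the spectrum, and if `Spec(u) ⊆ [-b, b]` and `χ = 1` on a larger interval, `χ` can
be replaced by ever wider bump functions. These form an approximate identity, so `K χ * u = u`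
(`scalarConv_angularFourierInv_eq_self`).

*Growth of multipliers.* If `‖h‖ ≤ q` on the support of `χ`, then `‖K (h ^ n χ)‖₁ = O(r ^ n)` for
every `r > q` (`exists_integral_norm_angularFourierInv_pow_mul_le`): the `L¹` norm of `K g` is a
continuous seminorm on Schwartz space, so finitely many Schwartz seminorms of `h ^ n χ` control it,
and these exceed `q ^ n` by at most a polynomial factor.

*Upper bound.* From `u = K χ * u` follows `D ^ n u = K ((i s) ^ n χ) * u`, so `u` is smooth and,
with `h = i s`, `‖D ^ n u‖ = O(r ^ n)` for every `r > ρ(u)` (`exists_norm_iteratedDeriv_le`).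

*Lower bound and converse.* Let `‖D ^ n u‖ ≤ r ^ n` for infinitely many `n` and let `χ` be supported
in `|s| ≥ δ > r`. Then `χ = (i s) ^ n (h ^ n χ)` with `h = (i s)⁻¹`, and integration by parts gives
`K χ * u = K (h ^ n χ) * D ^ n u`, whose norm is `O(p ^ n r ^ n)` for some `p < 1 / r`; so
`K χ * u = 0`. An arbitrary `φ ∈ L¹` with `φ̂` supported where `χ = 1` satisfies `φ = φ * K χ`,
hence `φ * u = 0`. Therefore `Spec(u) ⊆ [-r, r]` (`abs_le_of_mem_beurlingSpectrum`), which yields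
both `ρ(u) ≤ liminf ‖D ^ n u‖ ^ (1 / n)` and the compactness of the spectrum.
-/

open scoped SchwartzMap FourierTransform Manifold

/-! ### The angular Fourier transform on Schwartz functions -/

/-- The dilation `s ↦ c * s` of the real line, for `c ≠ 0`. -/
noncomputable def dilation {c : ℝ} (hc : c ≠ 0) : ℝ ≃L[ℝ] ℝ :=
  ContinuousLinearEquiv.unitsEquivAut ℝ (Units.mk0 c hc)

@[simp]
lemma dilation_apply {c : ℝ} (hc : c ≠ 0) (s : ℝ) : dilation hc s = c * s := by
  simp [dilation, mul_comm]

/-- The inverse of the angular Fourier transform on Schwartz functions,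
`χ ↦ (t ↦ (2π)⁻¹ ∫ e^{ist} χ(s) ds)`, written as Mathlib's inverse Fourier transform of
`s ↦ χ (2π s)`. -/
noncomputable def angularFourierInv : 𝓢(ℝ, ℂ) →L[ℂ] 𝓢(ℝ, ℂ) :=
  (FourierTransform.fourierCLE ℂ 𝓢(ℝ, ℂ)).symm.toContinuousLinearMap ∘L
    SchwartzMap.compCLMOfContinuousLinearEquiv ℂ (dilation Real.two_pi_pos.ne')

lemma angularFourierInv_eq (χ : 𝓢(ℝ, ℂ)) :
    angularFourierInv χ =
      𝓕⁻ (SchwartzMap.compCLMOfContinuousLinearEquiv ℂ (dilation Real.two_pi_pos.ne') χ) := rfl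

lemma angularFourier_eq_fourier (φ : ℝ → ℂ) (s : ℝ) :
    angularFourier φ s = 𝓕 φ (s / (2 * Real.pi)) := by
  rw [angularFourier, Real.fourier_real_eq_integral_exp_smul]
  refine integral_congr_ae (Eventually.of_forall fun t => ?_)
  simp only [smul_eq_mul]
  congr 2
  push_cast
  field_simp

lemma angularFourier_sub {φ ψ : ℝ → ℂ} (hφ : Integrable φ) (hψ : Integrable ψ) (s : ℝ) :
    angularFourier (φ - ψ) s = angularFourier φ s - angularFourier ψ s := by
  have hint : ∀ {f : ℝ → ℂ}, Integrable f →
      Integrable fun t : ℝ => Complex.exp (-(Complex.I * s * t)) * f t := fun {f} hf => by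
    refine hf.bdd_mul (c := 1) (Continuous.aestronglyMeasurable (by fun_prop))
      (Eventually.of_forall fun t => ?_)
    rw [Complex.norm_exp]
    simp
  simp only [angularFourier, Pi.sub_apply, mul_sub]
  exact integral_sub (hint hφ) (hint hψ)

lemma angularFourier_angularFourierInv (χ : 𝓢(ℝ, ℂ)) :
    angularFourier (angularFourierInv χ) = χ := by
  ext s
  rw [angularFourier_eq_fourier, ← SchwartzMap.fourier_coe, angularFourierInv_eq,
    FourierTransform.fourier_fourierInv_eq]
  simp only [SchwartzMap.compCLMOfContinuousLinearEquiv_apply, Function.comp_apply, dilation_apply]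
  congr 1
  field_simp

lemma integral_angularFourierInv (χ : 𝓢(ℝ, ℂ)) : ∫ t, angularFourierInv χ t = χ 0 := by
  rw [← angularFourier_angularFourierInv χ]
  simp [angularFourier]

lemma angularFourierInv_dilation (χ : 𝓢(ℝ, ℂ)) {c : ℝ} (hc : 0 < c) (t : ℝ) :
    angularFourierInv
      (SchwartzMap.compCLMOfContinuousLinearEquiv ℂ (dilation (inv_pos.2 hc).ne') χ) t =
      c * angularFourierInv χ (c * t) := by
  rw [angularFourierInv_eq, angularFourierInv_eq, SchwartzMap.fourierInv_coe,
    SchwartzMap.fourierInv_coe, Real.fourierInv_eq', Real.fourierInv_eq']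
  have := Measure.integral_comp_mul_left
    (fun v : ℝ => Complex.exp ((↑(2 * Real.pi * inner ℝ v (c * t)) * Complex.I)) •
      (SchwartzMap.compCLMOfContinuousLinearEquiv ℂ (dilation Real.two_pi_pos.ne') χ) v) c⁻¹
  rw [inv_inv, abs_of_pos hc, Complex.real_smul] at this
  rw [← this]
  refine integral_congr_ae (Eventually.of_forall fun v => ?_)
  simp only [SchwartzMap.compCLMOfContinuousLinearEquiv_apply, Function.comp_apply, dilation_apply,
    RCLike.inner_apply, conj_trivial]
  congr 2
  · congr 3
    field_simp
  · rw [mul_left_comm]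

lemma hasTemperateGrowth_I_mul : (fun s : ℝ => Complex.I * (s : ℂ)).HasTemperateGrowth := by
  fun_prop

/-- Multiplication of Schwartz functions by `s ↦ i s`, the symbol of differentiation. -/
noncomputable def mulSymbol : 𝓢(ℝ, ℂ) →L[ℂ] 𝓢(ℝ, ℂ) :=
  SchwartzMap.smulLeftCLM ℂ fun s : ℝ => Complex.I * (s : ℂ)

lemma mulSymbol_iterate_apply (χ : 𝓢(ℝ, ℂ)) (n : ℕ) (s : ℝ) :
    (mulSymbol^[n] χ) s = (Complex.I * s) ^ n * χ s := by
  induction n with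
  | zero => simp
  | succ n ih =>
    rw [Function.iterate_succ_apply', mulSymbol,
      SchwartzMap.smulLeftCLM_apply_apply hasTemperateGrowth_I_mul, ← mulSymbol, ih, smul_eq_mul]
    ring

lemma deriv_angularFourierInv (χ : 𝓢(ℝ, ℂ)) :
    deriv (angularFourierInv χ) = angularFourierInv (mulSymbol χ) := by
  ext t
  have h := congrArg (fun f : 𝓢(ℝ, ℂ) => f t) (SchwartzMap.lineDerivOp_fourierInv_eq
    (SchwartzMap.compCLMOfContinuousLinearEquiv ℂ (dilation Real.two_pi_pos.ne') χ) (1 : ℝ))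
  simp only [SchwartzMap.lineDerivOp_apply_eq_fderiv] at h
  rw [angularFourierInv_eq, angularFourierInv_eq, ← fderiv_apply_one_eq_deriv, h]
  congr 2
  ext s
  have h1 : (fun x : ℝ => x).HasTemperateGrowth := by fun_prop
  simp only [_root_.smul_apply, SchwartzMap.smulLeftCLM_apply_apply h1, mulSymbol,
    SchwartzMap.compCLMOfContinuousLinearEquiv_apply, Function.comp_apply, dilation_apply,
    SchwartzMap.smulLeftCLM_apply_apply hasTemperateGrowth_I_mul, smul_eq_mul, Complex.real_smul,
    RCLike.inner_apply, conj_trivial, Complex.ofReal_mul, Complex.ofReal_ofNat, one_mul]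
  ring

lemma integral_fourier_mul_eq_of_integrable {f g : ℝ → ℂ} (hf : Integrable f) (hg : Integrable g) :
    ∫ s, 𝓕 f s * g s = ∫ t, f t * 𝓕 g t := by
  simpa using! VectorFourier.integral_bilin_fourierIntegral_eq_flip (ContinuousLinearMap.mul ℂ ℂ)
    (L := innerₗ ℝ) Real.continuous_fourierChar continuous_inner hf hg

/-- The Fourier transform is injective on `L¹`. -/
lemma ae_eq_zero_of_angularFourier_eq_zero {f : ℝ → ℂ} (hf : Integrable f)
    (h : angularFourier f = 0) : f =ᵐ[volume] 0 := by
  have hF : 𝓕 f = 0 := by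
    ext s
    have := congrFun h (2 * Real.pi * s)
    rwa [angularFourier_eq_fourier, mul_div_cancel_left₀ _ Real.two_pi_pos.ne'] at this
  refine ae_eq_zero_of_integral_contDiff_smul_eq_zero hf.locallyIntegrable fun g hg hgc => ?_
  have hgc' : HasCompactSupport (Complex.ofRealCLM ∘ g) := hgc.comp_left rfl
  let G : 𝓢(ℝ, ℂ) := hgc'.toSchwartzMap (Complex.ofRealCLM.contDiff.comp hg)
  have h2 := integral_fourier_mul_eq_of_integrable hf (𝓕⁻ G).integrable
  rw [hF, ← SchwartzMap.fourier_coe, FourierTransform.fourier_fourierInv_eq] at h2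
  simp only [Pi.zero_apply, zero_mul, integral_zero] at h2
  rw [h2]
  refine integral_congr_ae (Eventually.of_forall fun t => ?_)
  simp [G, mul_comm]

/-! ### Convolution of a scalar function with a bounded continuous function -/

section Convolution

variable {X : Type*} [NormedAddCommGroup X] [NormedSpace ℂ X]

lemma scalarConv_apply (φ : ℝ → ℂ) (u : ℝ → X) (s : ℝ) :
    scalarConv φ u s = ∫ t, φ t • u (s - t) := by
  simp [scalarConv, convolution_def]

lemma scalarConv_apply_swap (φ : ℝ → ℂ) (u : ℝ → X) (s : ℝ) :
    scalarConv φ u s = ∫ t, φ (s - t) • u t := by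
  simp [scalarConv, convolution_eq_swap]

lemma integrable_smul_comp_sub {φ : ℝ → ℂ} (hφ : Integrable φ) {u : ℝ → X} (hu : Continuous u)
    {C : ℝ} (hC : ∀ t, ‖u t‖ ≤ C) (s : ℝ) : Integrable fun t => φ t • u (s - t) :=
  hφ.smul_bdd C (by fun_prop) (Eventually.of_forall fun t => hC _)

lemma norm_scalarConv_le {φ : ℝ → ℂ} (hφ : Integrable φ) {u : ℝ → X}
    {C : ℝ} (hC : ∀ t, ‖u t‖ ≤ C) (s : ℝ) : ‖scalarConv φ u s‖ ≤ (∫ t, ‖φ t‖) * C := by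
  rw [scalarConv_apply, ← integral_mul_const]
  refine norm_integral_le_of_norm_le (hφ.norm.mul_const C) (Eventually.of_forall fun t => ?_)
  rw [norm_smul]
  exact mul_le_mul_of_nonneg_left (hC _) (norm_nonneg _)

lemma scalarConv_sub {φ ψ : ℝ → ℂ} (hφ : Integrable φ) (hψ : Integrable ψ) (u : ℝ →ᵇ X) :
    scalarConv (φ - ψ) u = scalarConv φ u - scalarConv ψ u := by
  ext s
  simp only [Pi.sub_apply, scalarConv_apply, sub_smul]
  exact integral_sub (integrable_smul_comp_sub hφ u.continuous u.norm_coe_le_norm s)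
    (integrable_smul_comp_sub hψ u.continuous u.norm_coe_le_norm s)

lemma scalarConv_finset_sum {ι : Type*} (S : Finset ι) {φ : ι → ℝ → ℂ}
    (hφ : ∀ i ∈ S, Integrable (φ i)) (u : ℝ →ᵇ X) :
    scalarConv (fun t => ∑ i ∈ S, φ i t) u = fun s => ∑ i ∈ S, scalarConv (φ i) u s := by
  ext s
  simp only [scalarConv_apply, Finset.sum_smul]
  exact integral_finsetSum S fun i hi =>
    integrable_smul_comp_sub (hφ i hi) u.continuous u.norm_coe_le_norm s

lemma scalarConv_congr_ae {φ ψ : ℝ → ℂ} (h : φ =ᵐ[volume] ψ) (u : ℝ → X) :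
    scalarConv φ u = scalarConv ψ u := by
  ext s
  rw [scalarConv_apply, scalarConv_apply]
  exact integral_congr_ae (h.mono fun t ht => by simp only [ht])

lemma scalarConv_assoc [CompleteSpace X] {φ ψ : ℝ → ℂ} (hφ : Integrable φ) (hψ : Integrable ψ)
    (u : ℝ →ᵇ X) : scalarConv (scalarConv φ ψ) u = scalarConv φ (scalarConv ψ u) := by
  ext s
  refine convolution_assoc' _ _ _ _ (fun x y z => by simp [mul_smul, smul_comm x y z])
    (hφ.ae_convolution_exists _ hψ) (Eventually.of_forall fun x => ?_) ?_
  · exact integrable_smul_comp_sub hψ u.continuous u.norm_coe_le_norm x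
  · have h1 := hφ.convolution_integrand (ContinuousLinearMap.mul ℂ ℂ) hψ
    have h2 := h1.smul_bdd (f := fun p : ℝ × ℝ => u (s - p.1)) ‖u‖
      (Continuous.aestronglyMeasurable (by fun_prop))
      (Eventually.of_forall fun p => u.norm_coe_le_norm _)
    refine h2.congr (Eventually.of_forall fun p => ?_)
    simp [Function.uncurry, mul_smul, smul_comm (φ p.2)]

/-! ### Differentiation of convolutions with Schwartz functions -/

/-- Locally uniform integrable domination of the translates of a Schwartz function. -/
lemma exists_norm_comp_sub_le_of_abs_sub_le (φ : 𝓢(ℝ, ℂ)) :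
    ∃ C : ℝ, ∀ s₀ s t : ℝ, |s - s₀| ≤ 1 → ‖φ (s - t)‖ ≤ C * (1 + (s₀ - t) ^ 2)⁻¹ := by
  obtain ⟨C₀, hC₀⟩ := φ.decay 0 0
  obtain ⟨C₂, hC₂⟩ := φ.decay 2 0
  refine ⟨3 * C₀ + 2 * C₂, fun s₀ s t hs => ?_⟩
  have h0 := hC₀.2 (s - t)
  have h2 := hC₂.2 (s - t)
  simp only [pow_zero, norm_iteratedFDeriv_zero, one_mul, Real.norm_eq_abs, sq_abs] at h0 h2
  rw [← div_eq_mul_inv, le_div_iff₀ (by positivity)]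
  have hs' : (s - s₀) ^ 2 ≤ 1 := by rw [← sq_abs]; nlinarith [abs_nonneg (s - s₀)]
  have h3 : (s₀ - t) ^ 2 ≤ 2 * (s - t) ^ 2 + 2 := by
    nlinarith [sq_nonneg ((s - t) + (s - s₀))]
  nlinarith [norm_nonneg (φ (s - t))]

lemma hasDerivAt_scalarConv (φ : 𝓢(ℝ, ℂ)) (u : ℝ →ᵇ X) (s : ℝ) :
    HasDerivAt (scalarConv φ u) (scalarConv (deriv φ) u s) s := by
  obtain ⟨C, hC⟩ := exists_norm_comp_sub_le_of_abs_sub_le (SchwartzMap.derivCLM ℂ ℂ φ)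
  have h := hasDerivAt_integral_of_dominated_loc_of_deriv_le (μ := volume)
    (F := fun s t => φ (s - t) • u t) (F' := fun s t => deriv φ (s - t) • u t)
    (bound := fun t => C * (1 + (s - t) ^ 2)⁻¹ * ‖u‖) (Metric.closedBall_mem_nhds s one_pos)
    (Eventually.of_forall fun x => Continuous.aestronglyMeasurable (by fun_prop))
    ?_ ?_ ?_ ?_ ?_
  · convert! h.2 using 1
    · exact funext fun s => scalarConv_apply_swap _ _ s
    · exact scalarConv_apply_swap _ _ s
  · exact (φ.integrable.comp_sub_left s).smul_bdd ‖u‖ u.continuous.aestronglyMeasurable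
      (Eventually.of_forall u.norm_coe_le_norm)
  · exact Continuous.aestronglyMeasurable
      (((SchwartzMap.derivCLM ℂ ℂ φ).continuous.comp (by fun_prop)).smul u.continuous)
  · refine Eventually.of_forall fun t x hx => ?_
    rw [norm_smul]
    exact mul_le_mul (hC s x t hx) (u.norm_coe_le_norm t) (norm_nonneg _)
      ((norm_nonneg _).trans (hC s x t hx))
  · exact ((integrable_inv_one_add_sq.comp_sub_left s).const_mul C).mul_const _
  · refine Eventually.of_forall fun t x hx => ?_
    exact ((φ.hasDerivAt (x - t)).comp_sub_const x t).smul_const (u t)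

lemma iteratedDeriv_scalarConv_angularFourierInv (χ : 𝓢(ℝ, ℂ)) (u : ℝ →ᵇ X) (n : ℕ) :
    iteratedDeriv n (scalarConv (angularFourierInv χ) u) =
      scalarConv (angularFourierInv (mulSymbol^[n] χ)) u := by
  induction n with
  | zero => simp
  | succ n ih =>
    rw [iteratedDeriv_succ, ih, Function.iterate_succ_apply', ← deriv_angularFourierInv]
    exact funext fun s => (hasDerivAt_scalarConv _ u s).deriv

lemma contDiff_scalarConv_angularFourierInv (χ : 𝓢(ℝ, ℂ)) (u : ℝ →ᵇ X) :
    ContDiff ℝ ∞ (scalarConv (angularFourierInv χ) u) := by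
  refine contDiff_of_differentiable_iteratedDeriv fun m _ => ?_
  rw [iteratedDeriv_scalarConv_angularFourierInv]
  exact fun s => (hasDerivAt_scalarConv _ u s).differentiableAt

/-! ### Integration by parts against functions of polynomial growth -/

/-- The function `f` is bounded by a polynomial, in the form `‖f t‖ ≤ C (1 + |t|) ^ k`. It is the
growth that a bounded `n`-th derivative leaves to the lower derivatives. -/
def PolynomiallyBounded (f : ℝ → X) : Prop :=
  ∃ (C : ℝ) (k : ℕ), ∀ t, ‖f t‖ ≤ C * (1 + |t|) ^ k

lemma PolynomiallyBounded.of_deriv {f : ℝ → X} (hf : Differentiable ℝ f)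
    (h : PolynomiallyBounded (deriv f)) : PolynomiallyBounded f := by
  obtain ⟨C, k, hC⟩ := h
  have hC0 : 0 ≤ C := by simpa using (norm_nonneg _).trans (hC 0)
  refine ⟨‖f 0‖ + C, k + 1, fun t => ?_⟩
  have h1 : ‖f t - f 0‖ ≤ C * (1 + |t|) ^ k * ‖t - 0‖ := by
    refine (convex_closedBall (0 : ℝ) |t|).norm_image_sub_le_of_norm_deriv_le (𝕜 := ℝ)
      (fun x _ => hf x) (fun x hx => (hC x).trans ?_) (by simp) (by simp)
    rw [mem_closedBall_zero_iff, Real.norm_eq_abs] at hx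
    gcongr
  rw [sub_zero, Real.norm_eq_abs] at h1
  have h2 : ‖f t‖ ≤ ‖f 0‖ + C * (1 + |t|) ^ k * |t| := by
    linarith [norm_sub_norm_le (f t) (f 0)]
  have h3 : (1 : ℝ) ≤ (1 + |t|) ^ (k + 1) := one_le_pow₀ (by linarith [abs_nonneg t])
  have h4 : 0 ≤ C * (1 + |t|) ^ k := by positivity
  rw [pow_succ] at h3 ⊢
  nlinarith [norm_nonneg (f 0)]

lemma PolynomiallyBounded.of_iteratedDeriv {f : ℝ → X} (hf : ContDiff ℝ ∞ f) {n : ℕ}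
    (h : PolynomiallyBounded (iteratedDeriv n f)) : PolynomiallyBounded f := by
  induction n generalizing f with
  | zero => simpa using h
  | succ n ih =>
    rw [iteratedDeriv_succ'] at h
    exact .of_deriv (hf.differentiable (by simp)) (ih (contDiff_infty_iff_deriv.1 hf).2 h)

lemma SchwartzMap.integrable_smul_comp_sub_of_polynomiallyBounded (φ : 𝓢(ℝ, ℂ)) {f : ℝ → X}
    (hf : Continuous f) (h : PolynomiallyBounded f) (s : ℝ) :
    Integrable fun t => φ t • f (s - t) := by
  obtain ⟨C, k, hC⟩ := h
  have hC0 : 0 ≤ C := by simpa using (norm_nonneg _).trans (hC 0)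
  have hI : Integrable fun t => C * (1 + |s|) ^ k * 2 ^ (k - 1) * (‖φ t‖ + ‖t‖ ^ k * ‖φ t‖) :=
    (φ.integrable.norm.add (φ.integrable_pow_mul volume k)).const_mul _
  refine hI.mono' (Continuous.aestronglyMeasurable (by fun_prop))
    (Eventually.of_forall fun t => ?_)
  have h1 : (1 + |s - t|) ^ k ≤ (1 + |s|) ^ k * (2 ^ (k - 1) * (1 + |t| ^ k)) := by
    calc (1 + |s - t|) ^ k ≤ ((1 + |s|) * (1 + |t|)) ^ k := by
          gcongr
          nlinarith [abs_sub s t, abs_nonneg s, abs_nonneg t]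
      _ = (1 + |s|) ^ k * (1 + |t|) ^ k := mul_pow _ _ _
      _ ≤ _ := by
          gcongr
          simpa using add_pow_le zero_le_one (abs_nonneg t) k
  rw [norm_smul]
  calc ‖φ t‖ * ‖f (s - t)‖ ≤ ‖φ t‖ * (C * ((1 + |s|) ^ k * (2 ^ (k - 1) * (1 + |t| ^ k)))) := by
        gcongr
        exact (hC _).trans (by gcongr)
    _ = _ := by rw [Real.norm_eq_abs]; ring

/-- Integration by parts: in a convolution with a Schwartz function, a derivative may be moved from
one factor to the other. -/
lemma scalarConv_deriv_left (φ : 𝓢(ℝ, ℂ)) {f : ℝ → X} (hf : ContDiff ℝ 1 f)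
    (h : PolynomiallyBounded (deriv f)) :
    scalarConv (deriv φ) f = scalarConv φ (deriv f) := by
  ext s
  have hd : Differentiable ℝ f := hf.differentiable one_ne_zero
  have h1 := (SchwartzMap.derivCLM ℂ ℂ φ).integrable_smul_comp_sub_of_polynomiallyBounded
    hf.continuous (h.of_deriv hd) s
  have h2 := φ.integrable_smul_comp_sub_of_polynomiallyBounded
    (hf.continuous_deriv le_rfl) h s
  have h3 := φ.integrable_smul_comp_sub_of_polynomiallyBounded hf.continuous (h.of_deriv hd) s
  have h4 := integral_eq_zero_of_hasDerivAt_of_integrable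
    (f' := fun t => deriv φ t • f (s - t) - φ t • deriv f (s - t)) (fun t => ?_) (h1.sub h2) h3
  · rw [scalarConv_apply, scalarConv_apply, ← sub_eq_zero, ← h4]
    exact (integral_sub h1 h2).symm
  · have h5 := (φ.hasDerivAt t).smul ((hd (s - t)).hasDerivAt.comp_const_sub s t)
    convert! h5 using 1
    rw [smul_neg]
    abel

lemma scalarConv_angularFourierInv_mulSymbol_iterate (χ : 𝓢(ℝ, ℂ)) (n : ℕ) {f : ℝ → X}
    (hf : ContDiff ℝ ∞ f) (h : PolynomiallyBounded (iteratedDeriv n f)) :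
    scalarConv (angularFourierInv (mulSymbol^[n] χ)) f =
      scalarConv (angularFourierInv χ) (iteratedDeriv n f) := by
  induction n generalizing f with
  | zero => simp
  | succ n ih =>
    have hf' : ContDiff ℝ ∞ (deriv f) := (contDiff_infty_iff_deriv.1 hf).2
    rw [iteratedDeriv_succ'] at h ⊢
    rw [← ih hf' h, Function.iterate_succ_apply', ← deriv_angularFourierInv]
    exact scalarConv_deriv_left _ (hf.of_le (by simp)) (.of_iteratedDeriv hf' h)

end Convolution

/-! ### The spectrum as a support, and the reproducing formula -/

section Localization

variable {X : Type*} [NormedAddCommGroup X] [NormedSpace ℂ X]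

lemma isClosed_beurlingSpectrum (u : ℝ →ᵇ X) : IsClosed (beurlingSpectrum u) := by
  rw [← isOpen_compl_iff, Metric.isOpen_iff]
  intro ξ hξ
  simp only [beurlingSpectrum, Set.mem_compl_iff, Set.mem_ofPred_eq, not_forall] at hξ
  obtain ⟨ε, hε, h⟩ := hξ
  refine ⟨ε / 2, half_pos hε, fun η hη hmem => h ?_⟩
  obtain ⟨φ, hφ, hsupp, hne⟩ := hmem (ε / 2) (half_pos hε)
  refine ⟨φ, hφ, hsupp.trans (Set.Ioo_subset_Ioo ?_ ?_), hne⟩ <;>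
  · rw [Real.ball_eq_Ioo] at hη
    linarith [hη.1, hη.2]

lemma exists_scalarConv_angularFourierInv_eq_zero {u : ℝ →ᵇ X} {ξ : ℝ}
    (hξ : ξ ∉ beurlingSpectrum u) :
    ∃ ε : ℝ, 0 < ε ∧ ∀ χ : 𝓢(ℝ, ℂ), tsupport χ ⊆ Set.Ioo (ξ - ε) (ξ + ε) →
      scalarConv (angularFourierInv χ) u = 0 := by
  simp only [beurlingSpectrum, Set.mem_ofPred_eq, not_forall, not_exists, not_and, not_not] at hξ
  obtain ⟨ε, hε, h⟩ := hξ
  exact ⟨ε, hε, fun χ hχ => h _ (angularFourierInv χ).integrable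
    (by rwa [angularFourier_angularFourierInv])⟩

/-- A smooth compactly supported symbol that vanishes near the spectrum acts as zero. The
definition of the spectrum gives this only for symbols supported in short intervals; a partition
of unity extends it to all compact supports. -/
lemma scalarConv_angularFourierInv_eq_zero_of_disjoint {u : ℝ →ᵇ X} {χ : 𝓢(ℝ, ℂ)}
    (hc : HasCompactSupport χ) (hd : Disjoint (tsupport χ) (beurlingSpectrum u)) :
    scalarConv (angularFourierInv χ) u = 0 := by
  choose! ε hε hzero using fun ξ (hξ : ξ ∉ beurlingSpectrum u) =>
    exists_scalarConv_angularFourierInv_eq_zero hξ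
  have hmem : ∀ ξ ∈ tsupport χ, ξ ∉ beurlingSpectrum u := fun ξ h1 h2 =>
    Set.disjoint_left.1 hd h1 h2
  obtain ⟨f, hf⟩ := SmoothPartitionOfUnity.exists_isSubordinate 𝓘(ℝ, ℝ) (isClosed_tsupport χ)
    (fun ξ : tsupport χ => Set.Ioo (ξ.1 - ε ξ.1) (ξ.1 + ε ξ.1)) (fun _ => isOpen_Ioo)
    (fun ξ hξ => Set.mem_iUnion.2 ⟨⟨ξ, hξ⟩, by
      have := hε ξ (hmem ξ hξ)
      constructor <;> simp only <;> linarith⟩)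
  have hfin := f.locallyFinite.finite_nonempty_inter_compact hc
  let S := hfin.toFinset
  have hsupp : ∀ i, tsupport (fun s => (f i s : ℂ) * χ s) ⊆ tsupport χ := fun i =>
    tsupport_mul_subset_right
  have hcomp : ∀ i, HasCompactSupport (fun s => (f i s : ℂ) * χ s) := fun i => hc.mul_left
  have hsm : ∀ i, ContDiff ℝ ∞ (fun s => (f i s : ℂ) * χ s) := fun i =>
    (Complex.ofRealCLM.contDiff.comp (f i).contMDiff.contDiff).mul (χ.smooth ⊤)
  let g : tsupport χ → 𝓢(ℝ, ℂ) := fun i => (hcomp i).toSchwartzMap (hsm i)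
  have hsum : χ = ∑ i ∈ S, g i := by
    ext s
    rw [_root_.sum_apply]
    change χ s = ∑ i ∈ S, (f i s : ℂ) * χ s
    rw [← Finset.sum_mul, ← Complex.ofReal_sum]
    by_cases hs : s ∈ tsupport χ
    · have h1 := f.sum_eq_one hs
      rw [finsum_eq_sum_of_support_subset (s := S)] at h1
      · rw [h1]; simp
      · intro i hi
        simp only [S, Set.Finite.coe_toFinset, Set.mem_ofPred_eq]
        exact ⟨s, hi, hs⟩
    · simp [image_eq_zero_of_notMem_tsupport hs]
  rw [hsum, map_sum]
  have : (⇑(∑ i ∈ S, angularFourierInv (g i)) : ℝ → ℂ) =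
      fun t => ∑ i ∈ S, angularFourierInv (g i) t := by
    ext t
    rw [_root_.sum_apply]
  rw [this, scalarConv_finset_sum _ fun i _ => (angularFourierInv (g i)).integrable]
  ext s
  refine Finset.sum_eq_zero fun i _ => ?_
  rw [hzero i.1 (hmem i.1 i.2) (g i) (subset_trans (tsupport_mul_subset_left.trans ?_) (hf i))]
  · rfl
  · exact closure_mono fun x hx => by simpa using hx

lemma scalarConv_angularFourierInv_congr {u : ℝ →ᵇ X} {χ₁ χ₂ : 𝓢(ℝ, ℂ)}
    (h₁ : HasCompactSupport χ₁) (h₂ : HasCompactSupport χ₂)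
    (hd : Disjoint (tsupport (χ₁ - χ₂)) (beurlingSpectrum u)) :
    scalarConv (angularFourierInv χ₁) u = scalarConv (angularFourierInv χ₂) u := by
  have h := scalarConv_angularFourierInv_eq_zero_of_disjoint (u := u) (χ := χ₁ - χ₂)
    (h₁.sub h₂) (by simpa using hd)
  rw [map_sub] at h
  exact sub_eq_zero.1 ((scalarConv_sub (angularFourierInv χ₁).integrable
    (angularFourierInv χ₂).integrable u).symm.trans h)

/-- Approximate identity: dilating a symbol `χ` recovers `χ 0 • u` in the limit. -/
lemma tendsto_scalarConv_angularFourierInv_dilation [CompleteSpace X] (χ : 𝓢(ℝ, ℂ)) (u : ℝ →ᵇ X)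
    (s : ℝ) {c : ℕ → ℝ} (hc : ∀ n, 0 < c n) (hlim : Tendsto c atTop atTop) :
    Tendsto (fun n => scalarConv (angularFourierInv
      (SchwartzMap.compCLMOfContinuousLinearEquiv ℂ (dilation (inv_pos.2 (hc n)).ne') χ)) u s)
      atTop (𝓝 (χ 0 • u s)) := by
  have heq : ∀ n, scalarConv (angularFourierInv
      (SchwartzMap.compCLMOfContinuousLinearEquiv ℂ (dilation (inv_pos.2 (hc n)).ne') χ)) u s =
      ∫ t, angularFourierInv χ t • u (s - (c n)⁻¹ * t) := fun n => by
    have h := Measure.integral_comp_mul_left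
      (fun t => angularFourierInv χ t • u (s - (c n)⁻¹ * t)) (c n)
    rw [abs_of_pos (inv_pos.2 (hc n)), eq_inv_smul_iff₀ (hc n).ne'] at h
    rw [scalarConv_apply, ← h, ← integral_smul]
    refine integral_congr_ae (Eventually.of_forall fun t => ?_)
    simp only
    rw [angularFourierInv_dilation _ (hc n), inv_mul_cancel_left₀ (hc n).ne', mul_smul, Complex.coe_smul]
  simp only [heq]
  rw [← integral_angularFourierInv χ, ← integral_smul_const]
  refine tendsto_integral_of_dominated_convergence
    (fun t => ‖angularFourierInv χ t‖ * ‖u‖) (fun n => Continuous.aestronglyMeasurable (by fun_prop))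
    ((angularFourierInv χ).integrable.norm.mul_const _) (fun n => Eventually.of_forall fun t => ?_)
    (Eventually.of_forall fun t => ?_)
  · rw [norm_smul]
    exact mul_le_mul_of_nonneg_left (u.norm_coe_le_norm _) (norm_nonneg _)
  · refine Tendsto.const_smul ?_ _
    have h1 : Tendsto (fun n => s - (c n)⁻¹ * t) atTop (𝓝 (s - 0 * t)) :=
      ((tendsto_inv_atTop_zero.comp hlim).mul_const t).const_sub s
    rw [zero_mul, sub_zero] at h1
    exact (u.continuous.tendsto s).comp h1

/-- The real bump function `f`, viewed as a complex-valued Schwartz function. -/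
noncomputable def ContDiffBump.toSchwartzMap {c : ℝ} (f : ContDiffBump c) : 𝓢(ℝ, ℂ) :=
  HasCompactSupport.toSchwartzMap (f := fun s => (f s : ℂ))
    (f.hasCompactSupport.comp_left (g := Complex.ofReal) rfl)
    (Complex.ofRealCLM.contDiff.comp f.contDiff)

@[simp]
lemma ContDiffBump.toSchwartzMap_apply {c : ℝ} (f : ContDiffBump c) (s : ℝ) :
    f.toSchwartzMap s = f s := rfl

lemma ContDiffBump.tsupport_toSchwartzMap {c : ℝ} (f : ContDiffBump c) :
    tsupport f.toSchwartzMap = Metric.closedBall c f.rOut := by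
  rw [← f.tsupport_eq]
  refine congrArg closure (Set.ext fun s => ?_)
  simp

/-- Reproducing formula: a function whose spectrum lies in `[-b, b]` is not changed by a symbol
that is `1` on a larger interval `[-a, a]`. -/
lemma scalarConv_angularFourierInv_eq_self [CompleteSpace X] {u : ℝ →ᵇ X} {a b : ℝ} (hba : b < a)
    (ha : 0 < a) (hu : ∀ ξ ∈ beurlingSpectrum u, |ξ| ≤ b) {χ : 𝓢(ℝ, ℂ)}
    (hc : HasCompactSupport χ) (hχ : ∀ s, |s| < a → χ s = 1) :
    scalarConv (angularFourierInv χ) u = u := by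
  let β : ContDiffBump (0 : ℝ) := ⟨1, 2, one_pos, one_lt_two⟩
  have hβc : HasCompactSupport β.toSchwartzMap := by
    rw [HasCompactSupport, β.tsupport_toSchwartzMap]
    exact isCompact_closedBall _ _
  ext s
  have hpos : ∀ n : ℕ, 0 < a + n := fun n => by positivity
  -- the bumps `s ↦ β (s / (a + n))` equal `1` on `[-a, a]`, so each of them acts as `χ` does
  have hlim := tendsto_scalarConv_angularFourierInv_dilation β.toSchwartzMap u s hpos
    (tendsto_atTop_add_const_left _ _ tendsto_natCast_atTop_atTop)
  have h0 : β.toSchwartzMap 0 = 1 := by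
    rw [β.toSchwartzMap_apply, β.one_of_mem_closedBall (by simp [β])]
    simp
  rw [h0, one_smul] at hlim
  refine tendsto_nhds_unique ((tendsto_congr fun n => ?_).1 tendsto_const_nhds) hlim
  refine (congrFun (scalarConv_angularFourierInv_congr ?_ hc ?_) s).symm
  · exact hβc.comp_homeomorph (dilation (inv_pos.2 (hpos n)).ne').toHomeomorph
  · have hsub : tsupport (SchwartzMap.compCLMOfContinuousLinearEquiv ℂ
        (dilation (inv_pos.2 (hpos n)).ne') β.toSchwartzMap - χ) ⊆ (Set.Ioo (-a) a)ᶜ := by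
      refine closure_minimal (fun x hx hxa => hx ?_) isOpen_Ioo.isClosed_compl
      have hxa' := abs_lt.2 hxa
      rw [_root_.sub_apply, hχ x hxa', SchwartzMap.compCLMOfContinuousLinearEquiv_apply,
        Function.comp_apply, β.toSchwartzMap_apply, β.one_of_mem_closedBall]
      · simp
      · rw [mem_closedBall_zero_iff, dilation_apply, norm_mul, norm_inv, Real.norm_eq_abs,
          Real.norm_eq_abs, abs_of_pos (hpos n), inv_mul_le_iff₀ (hpos n)]
        have : (0 : ℝ) ≤ n := n.cast_nonneg
        simp only [β]
        linarith
    refine Set.disjoint_left.2 fun x hx hxs => hsub hx ?_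
    exact abs_lt.1 ((hu x hxs).trans_lt hba)

end Localization

/-! ### Inverse Fourier transforms of powers times a cutoff -/

section PowerBounds

lemma exists_natCast_mul_pow_pred_le {a b : ℝ} (ha : 0 < a) (hab : a < b) :
    ∃ C : ℝ, 0 ≤ C ∧ ∀ n : ℕ, n * a ^ (n - 1) ≤ C * b ^ n := by
  have hb := ha.trans hab
  have h := tendsto_self_mul_const_pow_of_lt_one (r := a / b) (by positivity)
    ((div_lt_one hb).2 hab)
  obtain ⟨M, hM⟩ := h.bddAbove_range
  refine ⟨M / a, div_nonneg (by simpa using hM ⟨0, rfl⟩) ha.le, fun n => ?_⟩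
  have h1 : n * (a / b) ^ n ≤ M := hM ⟨n, rfl⟩
  rw [div_pow, ← mul_div_assoc, div_le_iff₀ (by positivity)] at h1
  rw [div_mul_eq_mul_div, le_div_iff₀ ha]
  refine le_trans (le_of_eq ?_) h1
  cases n with
  | zero => simp
  | succ n => simp [pow_succ]; ring

variable {h : ℝ → ℂ} {T : Set ℝ} {q : ℝ}

/-- The derivatives of `h ^ n * χ` grow no faster than `q ^ n` if `‖h‖ ≤ q` on the support of `χ`:
each differentiation costs only a factor `n`. -/
lemma exists_norm_iteratedDeriv_pow_mul_le (hh : ContDiff ℝ ∞ h) (hq : 0 < q)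
    (hT : ∀ s ∈ T, ‖h s‖ ≤ q) (j : ℕ) {χ : ℝ → ℂ} (hχ : ContDiff ℝ ∞ χ)
    (hc : HasCompactSupport χ) (hχT : tsupport χ ⊆ T) {r : ℝ} (hr : q < r) :
    ∃ C : ℝ, 0 ≤ C ∧ ∀ (n : ℕ) (s : ℝ),
      ‖iteratedDeriv j (fun s => h s ^ n * χ s) s‖ ≤ C * r ^ n := by
  induction j generalizing χ r with
  | zero =>
    obtain ⟨C, hC⟩ := hc.exists_bound_of_continuous hχ.continuous
    refine ⟨C, (norm_nonneg _).trans (hC 0), fun n s => ?_⟩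
    rw [iteratedDeriv_zero, norm_mul, norm_pow, mul_comm]
    by_cases hs : s ∈ tsupport χ
    · have := hT s (hχT hs)
      have hC0 := (norm_nonneg _).trans (hC 0)
      gcongr
      · exact hC s
      · linarith
    · rw [image_eq_zero_of_notMem_tsupport hs]
      have hC0 := (norm_nonneg _).trans (hC 0)
      have : 0 < r := hq.trans hr
      simp only [norm_zero, zero_mul]
      positivity
  | succ j ih =>
    obtain ⟨r', hr', hr'r⟩ := exists_between hr
    have hdh : ContDiff ℝ ∞ (deriv h) := (contDiff_infty_iff_deriv.1 hh).2
    have hdχ : ContDiff ℝ ∞ (deriv χ) := (contDiff_infty_iff_deriv.1 hχ).2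
    obtain ⟨C₁, hC₁, h₁⟩ := ih (χ := fun s => deriv h s * χ s) (hdh.mul hχ) hc.mul_left
      (tsupport_mul_subset_right.trans hχT) hr'
    obtain ⟨C₂, hC₂, h₂⟩ := ih hdχ hc.deriv ((tsupport_deriv_subset ..).trans hχT) hr
    obtain ⟨D, hD, hDn⟩ := exists_natCast_mul_pow_pred_le (hq.trans hr') hr'r
    refine ⟨C₁ * D + C₂, by positivity, fun n s => ?_⟩
    have hderiv : deriv (fun s => h s ^ n * χ s) =
        fun s => (n : ℂ) * (h s ^ (n - 1) * (deriv h s * χ s)) + h s ^ n * deriv χ s := by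
      ext s
      have := (((hh.differentiable (by simp) s).hasDerivAt.pow n).mul
        (hχ.differentiable (by simp) s).hasDerivAt).deriv
      refine Eq.trans ?_ (this.trans ?_)
      · rfl
      · simp only [Pi.pow_apply]
        ring
    have hs₁ : ContDiff ℝ j fun s => h s ^ (n - 1) * (deriv h s * χ s) :=
      ((hh.pow _).mul (hdh.mul hχ)).of_le (by exact_mod_cast le_top)
    have hs₂ : ContDiff ℝ j fun s => h s ^ n * deriv χ s :=
      ((hh.pow _).mul hdχ).of_le (by exact_mod_cast le_top)
    rw [iteratedDeriv_succ', hderiv, iteratedDeriv_fun_add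
      (contDiff_const.mul hs₁).contDiffAt hs₂.contDiffAt, iteratedDeriv_const_mul_field]
    calc _ ≤ n * (C₁ * r' ^ (n - 1)) + C₂ * r ^ n := by
          refine (norm_add_le _ _).trans (add_le_add ?_ (h₂ n s))
          rw [norm_mul, Complex.norm_natCast]
          exact mul_le_mul_of_nonneg_left (h₁ _ s) n.cast_nonneg
      _ = C₁ * (n * r' ^ (n - 1)) + C₂ * r ^ n := by ring
      _ ≤ C₁ * (D * r ^ n) + C₂ * r ^ n := by
          linarith [mul_le_mul_of_nonneg_left (hDn n) hC₁]
      _ = _ := by ring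

lemma exists_seminorm_pow_mul_le (hh : ContDiff ℝ ∞ h) (hq : 0 < q) (χ : 𝓢(ℝ, ℂ))
    (hc : HasCompactSupport χ) (hT : ∀ s ∈ tsupport χ, ‖h s‖ ≤ q) {r : ℝ} (hr : q < r) (k j : ℕ) :
    ∃ C : ℝ, 0 ≤ C ∧ ∀ (n : ℕ) (g : 𝓢(ℝ, ℂ)), (∀ s, g s = h s ^ n * χ s) →
      SchwartzMap.seminorm ℂ k j g ≤ C * r ^ n := by
  obtain ⟨C, hC, hb⟩ := exists_norm_iteratedDeriv_pow_mul_le hh hq hT j (χ.smooth ⊤) hc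
    subset_rfl hr
  obtain ⟨B, hB⟩ := hc.isCompact.isBounded.exists_norm_le
  have hr0 : 0 < r := hq.trans hr
  refine ⟨|B| ^ k * C, by positivity, fun n g hg => ?_⟩
  refine SchwartzMap.seminorm_le_bound' ℂ k j g (by positivity) fun s => ?_
  have hg' : (g : ℝ → ℂ) = fun s => h s ^ n * χ s := funext hg
  by_cases hs : s ∈ tsupport χ
  · rw [mul_assoc, hg']
    have h1 : |s| ≤ |B| := (hB s hs).trans (le_abs_self B)
    gcongr
    exact hb n s
  · have h0 : (g : ℝ → ℂ) =ᶠ[𝓝 s] fun _ => 0 := by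
      rw [hg']
      filter_upwards [(isClosed_tsupport χ).isOpen_compl.mem_nhds hs] with x hx
      rw [image_eq_zero_of_notMem_tsupport hx, mul_zero]
    rw [h0.iteratedDeriv_eq]
    simp only [iteratedDeriv_fun_const_zero, norm_zero, mul_zero]
    positivity

/-- The `L¹` norm of the inverse Fourier transform of `h ^ n * χ` grows no faster than `q ^ n` if
`‖h‖ ≤ q` on the support of `χ`. -/
lemma exists_integral_norm_angularFourierInv_pow_mul_le (hh : ContDiff ℝ ∞ h) (hq : 0 < q)
    (χ : 𝓢(ℝ, ℂ)) (hc : HasCompactSupport χ) (hT : ∀ s ∈ tsupport χ, ‖h s‖ ≤ q) {r : ℝ}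
    (hr : q < r) :
    ∃ C : ℝ, 0 ≤ C ∧ ∀ (n : ℕ) (g : 𝓢(ℝ, ℂ)), (∀ s, g s = h s ^ n * χ s) →
      ∫ t, ‖angularFourierInv g t‖ ≤ C * r ^ n := by
  let L : 𝓢(ℝ, ℂ) →L[ℂ] Lp ℂ 1 (volume : Measure ℝ) :=
    SchwartzMap.toLpCLM ℂ ℂ 1 volume ∘L angularFourierInv
  have hL : ∀ g, ‖L g‖ = ∫ t, ‖angularFourierInv g t‖ := fun g => SchwartzMap.norm_toLp_one
  obtain ⟨S, D, -, hD⟩ := Seminorm.bound_of_continuous (schwartz_withSeminorms ℂ ℝ ℂ)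
    ((normSeminorm ℂ (Lp ℂ 1 (volume : Measure ℝ))).comp L.toLinearMap)
    (continuous_norm.comp L.continuous)
  choose C hC hb using fun p : ℕ × ℕ => exists_seminorm_pow_mul_le hh hq χ hc hT hr p.1 p.2
  have hr0 : 0 < r := hq.trans hr
  refine ⟨D * ∑ p ∈ S, C p, mul_nonneg D.2 (Finset.sum_nonneg fun p _ => hC p),
    fun n g hg => ?_⟩
  rw [← hL]
  calc ‖L g‖ ≤ D * (S.sup (schwartzSeminormFamily ℂ ℝ ℂ)) g := hD g
    _ ≤ D * ((∑ p ∈ S, C p) * r ^ n) := by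
        gcongr
        refine Seminorm.finset_sup_apply_le
          (mul_nonneg (Finset.sum_nonneg fun p _ => hC p) (by positivity)) fun p hp => ?_
        refine (hb p n g hg).trans ?_
        gcongr
        exact Finset.single_le_sum (fun p _ => hC p) hp
    _ = _ := by ring

end PowerBounds

/-! ### Derivatives and the spectrum -/

section Spectrum

lemma norm_le_toReal_supENorm {X : Type*} [NormedAddCommGroup X] {f : ℝ → X} (hf : supENorm f ≠ ⊤) (t : ℝ) :
    ‖f t‖ ≤ (supENorm f).toReal := by
  rw [← toReal_enorm]
  exact ENNReal.toReal_mono hf (le_iSup (fun t => ‖f t‖ₑ) t)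

lemma supENorm_le_ofReal {X : Type*} [NormedAddCommGroup X] {f : ℝ → X} {M : ℝ} (h : ∀ t, ‖f t‖ ≤ M) :
    supENorm f ≤ ENNReal.ofReal M :=
  iSup_le fun t => by
    rw [← ofReal_norm]
    exact ENNReal.ofReal_le_ofReal (h t)

variable {X : Type*} [NormedAddCommGroup X] [NormedSpace ℂ X]

lemma exists_eq_angularFourierInv_of_abs_le [CompleteSpace X] {u : ℝ →ᵇ X} {b r : ℝ} (hb : 0 ≤ b)
    (hbr : b < r) (hu : ∀ ξ ∈ beurlingSpectrum u, |ξ| ≤ b) :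
    ∃ χ : 𝓢(ℝ, ℂ), HasCompactSupport χ ∧ tsupport χ ⊆ Metric.closedBall 0 r ∧
      scalarConv (angularFourierInv χ) u = u := by
  obtain ⟨a, hba, har⟩ := exists_between hbr
  let β : ContDiffBump (0 : ℝ) := ⟨a, r, hb.trans_lt hba, har⟩
  have hβ := β.tsupport_toSchwartzMap
  have hc : HasCompactSupport β.toSchwartzMap := by
    rw [HasCompactSupport, hβ]
    exact isCompact_closedBall _ _
  refine ⟨β.toSchwartzMap, hc, hβ.subset,
    scalarConv_angularFourierInv_eq_self hba (hb.trans_lt hba) hu hc fun s hs => ?_⟩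
  rw [β.toSchwartzMap_apply, β.one_of_mem_closedBall]
  · simp
  · simpa [β] using hs.le

lemma contDiff_of_abs_le [CompleteSpace X] {u : ℝ →ᵇ X} {b : ℝ} (hb : 0 ≤ b)
    (hu : ∀ ξ ∈ beurlingSpectrum u, |ξ| ≤ b) : ContDiff ℝ ∞ (u : ℝ → X) := by
  obtain ⟨χ, -, -, h⟩ := exists_eq_angularFourierInv_of_abs_le hb (lt_add_one b) hu
  rw [← h]
  exact contDiff_scalarConv_angularFourierInv χ u

/-- Bernstein's inequality, up to a constant and an arbitrarily small enlargement of the spectral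
radius. -/
lemma exists_norm_iteratedDeriv_le [CompleteSpace X] {u : ℝ →ᵇ X} {b r : ℝ} (hb : 0 ≤ b)
    (hbr : b < r) (hu : ∀ ξ ∈ beurlingSpectrum u, |ξ| ≤ b) :
    ∃ C : ℝ, 0 ≤ C ∧ ∀ (n : ℕ) (t : ℝ), ‖iteratedDeriv n (u : ℝ → X) t‖ ≤ C * r ^ n := by
  obtain ⟨q, hbq, hqr⟩ := exists_between hbr
  obtain ⟨χ, hc, hsupp, h⟩ := exists_eq_angularFourierInv_of_abs_le hb hbq hu
  have hh : ContDiff ℝ ∞ fun s : ℝ => Complex.I * (s : ℂ) :=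
    contDiff_const.mul Complex.ofRealCLM.contDiff
  obtain ⟨C, hC, hCn⟩ := exists_integral_norm_angularFourierInv_pow_mul_le hh (hb.trans_lt hbq) χ hc
    (fun s hs => by simpa using hsupp hs) hqr
  refine ⟨C * ‖u‖, by positivity, fun n t => ?_⟩
  rw [← h, iteratedDeriv_scalarConv_angularFourierInv]
  refine (norm_scalarConv_le (angularFourierInv _).integrable u.norm_coe_le_norm t).trans ?_
  rw [mul_right_comm]
  exact mul_le_mul_of_nonneg_right (hCn n _ (mulSymbol_iterate_apply χ n)) (norm_nonneg _)

/-- A smooth function equal to `s ↦ (i s)⁻¹` away from the interval `(-δ, δ)`. -/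
lemma exists_contDiff_eq_inv_I_mul {δ : ℝ} (hδ : 0 < δ) :
    ∃ h : ℝ → ℂ, ContDiff ℝ ∞ h ∧ ∀ s, δ ≤ |s| → h s = (Complex.I * s)⁻¹ := by
  let β : ContDiffBump (0 : ℝ) := ⟨δ / 2, δ, half_pos hδ, half_lt_self hδ⟩
  refine ⟨fun s => (1 - (β s : ℂ)) * (Complex.I * s)⁻¹, contDiff_iff_contDiffAt.2 fun s => ?_,
    fun s hs => ?_⟩
  · rcases eq_or_ne s 0 with rfl | hs
    · refine (contDiffAt_const (c := (0 : ℂ))).congr_of_eventuallyEq ?_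
      filter_upwards [β.eventuallyEq_one] with x hx
      simp [hx]
    · refine ContDiffAt.mul ?_ ?_
      · exact contDiffAt_const.sub (Complex.ofRealCLM.contDiff.comp β.contDiff).contDiffAt
      · exact (contDiffAt_const.mul Complex.ofRealCLM.contDiff.contDiffAt).inv (by simpa using hs)
  · simp only
    rw [β.zero_of_le_dist (by simpa [β] using hs)]
    simp

/-- If `‖D ^ n u‖` is below `r ^ n` for infinitely many `n`, symbols supported outside `[-r, r]`
act as zero: such a symbol is `(i s) ^ n` times `(i s) ^ (-n) χ`, and the `L¹` norm of the inverse
Fourier transform of the latter decays faster than `r ^ (-n)`. -/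
lemma scalarConv_angularFourierInv_eq_zero_of_frequently {u : ℝ →ᵇ X}
    (hu : ContDiff ℝ ∞ (u : ℝ → X)) {r δ : ℝ} (hr : 0 < r) (hrδ : r < δ)
    (hfreq : ∃ᶠ n : ℕ in atTop, ∀ t, ‖iteratedDeriv n (u : ℝ → X) t‖ ≤ r ^ n) {χ : 𝓢(ℝ, ℂ)}
    (hc : HasCompactSupport χ) (hχ : ∀ s ∈ tsupport χ, δ ≤ |s|) :
    scalarConv (angularFourierInv χ) u = 0 := by
  have hδ := hr.trans hrδ
  obtain ⟨h, hh, heq⟩ := exists_contDiff_eq_inv_I_mul hδ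
  -- a rate `p` strictly between `1 / δ` and `1 / r`, so that `p * r < 1`
  obtain ⟨p, hδp, hpr⟩ := exists_between (inv_strictAnti₀ hr hrδ)
  have hp : 0 < p := (inv_pos.2 hδ).trans hδp
  obtain ⟨C, hC, hCn⟩ := exists_integral_norm_angularFourierInv_pow_mul_le hh (inv_pos.2 hδ) χ hc
    (fun s hs => by
      rw [heq s (hχ s hs), norm_inv, norm_mul, Complex.norm_I, one_mul, Complex.norm_real]
      exact inv_anti₀ hδ (hχ s hs)) hδp
  have hpr1 : p * r < 1 := by
    have := mul_lt_mul_of_pos_right hpr hr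
    rwa [inv_mul_cancel₀ hr.ne'] at this
  ext s
  have hlim : Tendsto (fun n : ℕ => C * (p * r) ^ n) atTop (𝓝 0) := by
    simpa using (tendsto_pow_atTop_nhds_zero_of_lt_one (by positivity) hpr1).const_mul C
  have hle : ∃ᶠ n : ℕ in atTop,
      ‖scalarConv (angularFourierInv χ) u s‖ ≤ C * (p * r) ^ n := by
    refine hfreq.mono fun n hn => ?_
    let g : 𝓢(ℝ, ℂ) := HasCompactSupport.toSchwartzMap (f := fun s => h s ^ n * χ s) hc.mul_left
      ((hh.pow n).mul (χ.smooth ⊤))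
    have hg : mulSymbol^[n] g = χ := by
      ext x
      rw [mulSymbol_iterate_apply]
      change (Complex.I * x) ^ n * (h x ^ n * χ x) = χ x
      by_cases hx : x ∈ tsupport χ
      · have hx0 : (Complex.I * (x : ℂ)) ≠ 0 := by
          have := abs_pos.1 (hδ.trans_le (hχ x hx))
          simpa using this
        rw [heq x (hχ x hx), ← mul_assoc, ← mul_pow, mul_inv_cancel₀ hx0, one_pow, one_mul]
      · simp [image_eq_zero_of_notMem_tsupport hx]
    rw [← hg, scalarConv_angularFourierInv_mulSymbol_iterate g n hu
      ⟨r ^ n, 0, fun t => by simpa using hn t⟩, mul_pow, ← mul_assoc]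
    refine (norm_scalarConv_le (angularFourierInv g).integrable hn s).trans ?_
    exact mul_le_mul_of_nonneg_right (hCn n g fun _ => rfl) (by positivity)
  by_contra hne
  have hpos : 0 < ‖scalarConv (angularFourierInv χ) u s‖ := norm_pos_iff.2 hne
  obtain ⟨n, h1, h2⟩ := (hle.and_eventually (hlim.eventually_lt_const hpos)).exists
  exact absurd h1 (not_le.2 h2)

/-- A symbol that is `1` where `φ̂` lives reproduces `φ`, so the test functions in the
definition of the spectrum factor through Schwartz functions. -/
lemma ae_eq_scalarConv_angularFourierInv {φ : ℝ → ℂ} (hφ : Integrable φ) {χ : 𝓢(ℝ, ℂ)}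
    (h : ∀ s ∈ tsupport (angularFourier φ), χ s = 1) :
    φ =ᵐ[volume] scalarConv φ (angularFourierInv χ) := by
  have hψ := (angularFourierInv χ).integrable (μ := volume)
  have hconv : Integrable (scalarConv φ (angularFourierInv χ)) :=
    hφ.integrable_convolution (ContinuousLinearMap.lsmul ℂ ℂ) hψ
  have hzero := ae_eq_zero_of_angularFourier_eq_zero (hφ.sub hconv) ?_
  · exact hzero.mono fun t ht => sub_eq_zero.1 ht
  · ext s
    have h1 : angularFourier (scalarConv φ (angularFourierInv χ)) s =
        angularFourier φ s * χ s := by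
      have h2 := congrFun (angularFourier_angularFourierInv χ) s
      rw [angularFourier_eq_fourier] at h2
      rw [angularFourier_eq_fourier, angularFourier_eq_fourier, ← h2]
      exact Real.fourier_smul_convolution_eq hφ hψ _
    have h2 := angularFourier_sub hφ hconv s
    rw [h2, h1]
    by_cases hs : s ∈ tsupport (angularFourier φ)
    · simp [h s hs]
    · simp [image_eq_zero_of_notMem_tsupport hs]

/-- If `‖D ^ n u‖ ≤ r ^ n` for infinitely many `n`, then `Spec(u) ⊆ [-r, r]`. -/
lemma abs_le_of_mem_beurlingSpectrum [CompleteSpace X] {u : ℝ →ᵇ X}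
    (hu : ContDiff ℝ ∞ (u : ℝ → X)) {r : ℝ} (hr : 0 < r)
    (hfreq : ∃ᶠ n : ℕ in atTop, ∀ t, ‖iteratedDeriv n (u : ℝ → X) t‖ ≤ r ^ n) {ξ : ℝ}
    (hξ : ξ ∈ beurlingSpectrum u) : |ξ| ≤ r := by
  by_contra! hlt
  obtain ⟨ε, hε, hξε⟩ : ∃ ε : ℝ, 0 < ε ∧ r + 3 * ε = |ξ| := ⟨(|ξ| - r) / 3, by linarith, by ring⟩
  obtain ⟨φ, hφ, hsupp, hne⟩ := hξ ε hε
  let β : ContDiffBump ξ := ⟨ε, 2 * ε, hε, by linarith⟩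
  have hβ := β.tsupport_toSchwartzMap
  have hc : HasCompactSupport β.toSchwartzMap := by
    rw [HasCompactSupport, hβ]
    exact isCompact_closedBall _ _
  have hψ := scalarConv_angularFourierInv_eq_zero_of_frequently hu hr (δ := r + ε) (by linarith)
    hfreq hc (fun s hs => by
      rw [hβ, Metric.mem_closedBall, dist_comm, Real.dist_eq] at hs
      have := abs_sub_abs_le_abs_sub ξ s
      change _ ≤ 2 * ε at hs
      linarith)
  refine hne ?_
  rw [scalarConv_congr_ae (ae_eq_scalarConv_angularFourierInv hφ (χ := β.toSchwartzMap)
    fun s hs => ?_) u, scalarConv_assoc hφ (angularFourierInv _).integrable u, hψ]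
  · ext s
    simp [scalarConv_apply]
  · rw [β.toSchwartzMap_apply, β.one_of_mem_closedBall]
    · simp
    · exact Metric.ball_subset_closedBall (Real.ball_eq_Ioo ξ ε ▸ hsupp hs)

lemma abs_le_of_frequently_supENorm_lt [CompleteSpace X] {u : ℝ →ᵇ X}
    (hu : ContDiff ℝ ∞ (u : ℝ → X)) {r : ℝ} (hr : 0 < r)
    (hfreq : ∃ᶠ n : ℕ in atTop,
      supENorm (iteratedDeriv n (u : ℝ → X)) ^ (1 / (n : ℝ)) < ENNReal.ofReal r) {ξ : ℝ}
    (hξ : ξ ∈ beurlingSpectrum u) : |ξ| ≤ r := by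
  refine abs_le_of_mem_beurlingSpectrum hu hr ?_ hξ
  refine (hfreq.and_eventually (eventually_gt_atTop 0)).mono fun n ⟨hn, hn0⟩ t => ?_
  have hn' : (0 : ℝ) < n := Nat.cast_pos.2 hn0
  rw [one_div, ENNReal.rpow_inv_lt_iff hn', ENNReal.rpow_natCast,
    ← ENNReal.ofReal_pow hr.le] at hn
  refine (norm_le_toReal_supENorm (hn.trans_le le_top).ne t).trans ?_
  exact ENNReal.toReal_le_of_le_ofReal (by positivity) hn.le

lemma eventually_supENorm_le [CompleteSpace X] {u : ℝ →ᵇ X} {b r : ℝ} (hb : 0 ≤ b)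
    (hbr : b < r) (hu : ∀ ξ ∈ beurlingSpectrum u, |ξ| ≤ b) :
    ∀ᶠ n : ℕ in atTop,
      supENorm (iteratedDeriv n (u : ℝ → X)) ^ (1 / (n : ℝ)) ≤ ENNReal.ofReal r := by
  obtain ⟨q, hbq, hqr⟩ := exists_between hbr
  obtain ⟨C, hC, hCn⟩ := exists_norm_iteratedDeriv_le hb hbq hu
  have hq : 0 < q := hb.trans_lt hbq
  have hr : 0 < r := hq.trans hqr
  have hlim : Tendsto (fun n : ℕ => C * (q / r) ^ n) atTop (𝓝 0) := by
    simpa using (tendsto_pow_atTop_nhds_zero_of_lt_one (by positivity)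
      ((div_lt_one hr).2 hqr)).const_mul C
  filter_upwards [hlim.eventually_le_const one_pos, eventually_gt_atTop 0] with n hn hn0
  have hn' : (0 : ℝ) < n := Nat.cast_pos.2 hn0
  rw [one_div, ENNReal.rpow_inv_le_iff hn', ENNReal.rpow_natCast, ← ENNReal.ofReal_pow hr.le]
  refine supENorm_le_ofReal fun t => (hCn n t).trans ?_
  rwa [div_pow, ← mul_div_assoc, div_le_one (by positivity)] at hn

end Spectrum

theorem theorem1 {X : Type*} [NormedAddCommGroup X] [NormedSpace ℂ X] [CompleteSpace X]
    (u : ℝ →ᵇ X) :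
    (IsCompact (beurlingSpectrum u) →
      ContDiff ℝ ∞ (u : ℝ → X) ∧
      (∀ n : ℕ, ∃ v : ℝ →ᵇ X, (v : ℝ → X) = iteratedDeriv n (u : ℝ → X)) ∧
      Tendsto (fun n : ℕ => supENorm (iteratedDeriv n (u : ℝ → X)) ^ (1 / (n : ℝ))) atTop
        (𝓝 (beurlingRadius u))) ∧
    (ContDiff ℝ ∞ (u : ℝ → X) →
      liminf (fun n : ℕ => supENorm (iteratedDeriv n (u : ℝ → X)) ^ (1 / (n : ℝ))) atTop < ⊤ →
      IsCompact (beurlingSpectrum u)) := by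
  refine ⟨fun hK => ?_, fun hu hlim => ?_⟩
  · obtain ⟨B, hB0, hB⟩ := hK.isBounded.exists_pos_norm_le
    have hsmooth : ContDiff ℝ ∞ (u : ℝ → X) := contDiff_of_abs_le hB0.le hB
    refine ⟨hsmooth, fun n => ?_, ?_⟩
    · obtain ⟨C, -, hC⟩ := exists_norm_iteratedDeriv_le hB0.le (lt_add_one B) hB
      exact ⟨BoundedContinuousFunction.ofNormedAddCommGroup _
        (hsmooth.continuous_iteratedDeriv n (by exact_mod_cast le_top)) _ (hC n), rfl⟩
    · have hrad : beurlingRadius u ≠ ⊤ := by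
        refine ne_top_of_le_ne_top (b := ENNReal.ofReal B) ENNReal.ofReal_ne_top ?_
        exact iSup₂_le fun ξ hξ => ENNReal.ofReal_le_ofReal (hB ξ hξ)
      have hspec : ∀ ξ ∈ beurlingSpectrum u, |ξ| ≤ (beurlingRadius u).toReal := fun ξ hξ =>
        (ENNReal.ofReal_le_iff_le_toReal hrad).1
          (le_iSup₂ (f := fun ξ (_ : ξ ∈ beurlingSpectrum u) => ENNReal.ofReal |ξ|) ξ hξ)
      refine tendsto_of_le_liminf_of_limsup_le ?_ ?_
      · by_contra! hlt
        obtain ⟨c, hc₁, hc₂⟩ := exists_between hlt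
        have hc : c ≠ ⊤ := (hc₂.trans_le le_top).ne
        have hc0 : 0 < c.toReal := ENNReal.toReal_pos (zero_le.trans_lt hc₁).ne' hc
        have hfreq := frequently_lt_of_liminf_lt (by isBoundedDefault) hc₁
        rw [← ENNReal.ofReal_toReal hc] at hfreq
        refine hc₂.not_ge (iSup₂_le fun ξ hξ => ?_)
        exact (ENNReal.ofReal_le_iff_le_toReal hc).2
          (abs_le_of_frequently_supENorm_lt hsmooth hc0 hfreq hξ)
      · refine le_of_forall_gt_imp_ge_of_dense fun c hc => ?_
        rcases eq_or_ne c ⊤ with rfl | hc'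
        · exact le_top
        · rw [← ENNReal.ofReal_toReal hc']
          refine limsup_le_of_le (by isBoundedDefault) ?_
          exact eventually_supENorm_le ENNReal.toReal_nonneg
            ((ENNReal.toReal_lt_toReal hrad hc').2 hc) hspec
  · obtain ⟨c, hc₁, hc₂⟩ := exists_between hlim
    have hfreq := frequently_lt_of_liminf_lt (by isBoundedDefault) hc₁
    have hc0 : 0 < c.toReal := ENNReal.toReal_pos (zero_le.trans_lt hc₁).ne' hc₂.ne
    rw [← ENNReal.ofReal_toReal hc₂.ne] at hfreq
    refine Metric.isCompact_of_isClosed_isBounded (isClosed_beurlingSpectrum u)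
      (Metric.isBounded_closedBall.subset (t := Metric.closedBall 0 c.toReal) fun ξ hξ => ?_)
    simpa using abs_le_of_frequently_supENorm_lt hu hc0 hfreq hξ
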